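/- Work in the language of second order arithmetic with number symbols $0,1,\exp,+,\cdot,<$ (where $\exp(x)=2^x$) and membership $\in$. $\mathrm{ECA}_0$ (respectively $\mathrm{ACA}_0$) consists of the defining axioms of the number symbols, the set induction axiom, and comprehension for elementary, i.e. $\Delta^0_0$, formulas (respectively for arithmetical formulas), with parameters. Let $U$ be a theory in this language that extends $\mathrm{ECA}_0$, and let $\Box_U(x)$ be a $\Sigma^0_1$ formula that defines provability in $U$, that is, $\mathbb N\models\Box_U(n)$ if and only if $n$ is the Gödel number of a theorem of $U$. Fix arithmetical formulas representing a system of ordinal notations $\Lambda$ and its ordering $\prec$, with $\prec$ provably (in $\mathrm{ECA}_0$) transitive; write $\alpha\preceq\gamma$ for $\alpha\prec\gamma\vee\alpha=\gamma$. The variables $\alpha,\beta,\gamma$ range over $\Lambda$ and $\varphi,\psi$ range over (Gödel numbers of) formulas. Let $1\text{-}\mathsf{IMC}(X,\gamma)$ be a formula, with only $X$ and $\gamma$ free, that satisfies, provably in $\mathrm{ECA}_0$, for all $X$ and $\gamma$ the recursion \[ 1\text{-}\mathsf{IMC}(X,\gamma)\ \leftrightarrow\ \forall\,\alpha{\preceq}\gamma\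 \forall\varphi\,\Big[\langle\alpha,\varphi\rangle\in X\leftrightarrow \Box_U\varphi\ \vee\ \exists\,\beta{\prec}\alpha\,\exists\psi\,\Big(\langle\beta,\neg\psi\rangle\notin X\ \wedge\ \Box_U\big[\exists X\,\big(1\text{-}\mathsf{IMC}(X,\dot\beta)\wedge\langle\dot\beta,\neg\dot\psi\rangle\notin X\big)\to\varphi\big]\Big)\Big], \] where the dots indicate that numerals are substituted. Let $\mathsf{wo}(\alpha)$ be the formula expressing that $\prec$ strictly linearly orders $\{\beta:\beta\prec\alpha\}$ and that every set meeting $\{\beta:\beta\prec\alpha\}$ has a $\prec$-least element in it. Then \[ \mathrm{ACA}_0\ \vdash\ \forall\alpha\,\Big(\mathsf{wo}(\alpha)\to\forall X\,\forall Y\,\big(1\text{-}\mathsf{IMC}(X,\alpha)\wedge 1\text{-}\mathsf{IMC}(Y,\alpha)\to\forall\,\beta{\preceq}\alpha\ \forall\varphi\,(\langle\beta,\varphi\rangle\in X\leftrightarrow\langle\beta,\varphi\rangle\in Y)\big)\Big). \] That is, $\mathrm{ACA}_0+\mathsf{wo}(\alpha)$ proves that there is, up to agreement on the pairs $\langle\beta,\varphi\rangle$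 with $\beta\preceq\alpha$, at most one iterated one-Münchhausen class up to $\alpha$. -/

import Mathlib

namespace Munchhausen

/-! ## The language of second order arithmetic -/

/-- Number terms over `0, 1, exp, +, ·` (`exp` is `x ↦ 2 ^ x`); variables are de Bruijn indices. -/
inductive Tm : Type
  | var (i : ℕ)
  | zero
  | one
  | exp (t : Tm)
  | add (t u : Tm)
  | mul (t u : Tm)

/-- Formulas. Number variables and set variables are two independent families of de Bruijn indices:
`all` binds number variable `0` and `allS` binds set variable `0`. -/
inductive Fm : Type
  | eq (t u : Tm)
  | lt (t u : Tm)
  | mem (t : Tm) (X : ℕ)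
  | bot
  | imp (φ ψ : Fm)
  | all (φ : Fm)
  | allS (φ : Fm)

instance : Zero Tm := ⟨.zero⟩
instance : One Tm := ⟨.one⟩
instance : Add Tm := ⟨.add⟩
instance : Mul Tm := ⟨.mul⟩

namespace Tm

/-- Simultaneous substitution of terms for number variables. -/
def subst (σ : ℕ → Tm) : Tm → Tm
  | var i => σ i
  | zero => zero
  | one => one
  | exp t => exp (t.subst σ)
  | add t u => add (t.subst σ) (u.subst σ)
  | mul t u => mul (t.subst σ) (u.subst σ)

/-- Weakening by one number variable. -/
def lift (t : Tm) : Tm := t.subst fun i => var (i + 1)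

/-- All variables are among the first `n`. -/
def Closed (n : ℕ) : Tm → Prop
  | var i => i < n
  | zero => True
  | one => True
  | exp t => t.Closed n
  | add t u => t.Closed n ∧ u.Closed n
  | mul t u => t.Closed n ∧ u.Closed n

/-- Value in the standard model. -/
def eval (v : ℕ → ℕ) : Tm → ℕ
  | var i => v i
  | zero => 0
  | one => 1
  | exp t => 2 ^ t.eval v
  | add t u => t.eval v + u.eval v
  | mul t u => t.eval v * u.eval v

end Tm

/-- Prepend a value to a sequence. -/
def cons {A : Type*} (a : A) (f : ℕ → A) : ℕ → A
  | 0 => a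
  | n + 1 => f n

namespace Fm

/-- Simultaneous substitution: terms for number variables, set variables for set variables. -/
def subst (σ : ℕ → Tm) (ρ : ℕ → ℕ) : Fm → Fm
  | eq t u => eq (t.subst σ) (u.subst σ)
  | lt t u => lt (t.subst σ) (u.subst σ)
  | mem t X => mem (t.subst σ) (ρ X)
  | bot => bot
  | imp φ ψ => imp (φ.subst σ ρ) (ψ.subst σ ρ)
  | all φ => all (φ.subst (cons (.var 0) fun i => (σ i).lift) ρ)
  | allS φ => allS (φ.subst σ (cons 0 fun i => ρ i + 1))

/-- Weakening by one number variable. -/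
def lift (φ : Fm) : Fm := φ.subst (fun i => .var (i + 1)) id

/-- Weakening by one set variable. -/
def liftS (φ : Fm) : Fm := φ.subst .var (fun i => i + 1)

/-- `φ(t)`: instantiate number variable `0`. -/
def inst (φ : Fm) (t : Tm) : Fm := φ.subst (cons t .var) id

/-- `φ(X)`: instantiate set variable `0` by the set variable `X`. -/
def instS (φ : Fm) (X : ℕ) : Fm := φ.subst .var (cons X id)

/-- All free number variables are among the first `n`, all free set variables among the first
`m`. -/
def Closed : ℕ → ℕ → Fm → Prop
  | n, _, eq t u => t.Closed n ∧ u.Closed n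
  | n, _, lt t u => t.Closed n ∧ u.Closed n
  | n, m, mem t X => t.Closed n ∧ X < m
  | _, _, bot => True
  | n, m, imp φ ψ => φ.Closed n m ∧ ψ.Closed n m
  | n, m, all φ => φ.Closed (n + 1) m
  | n, m, allS φ => φ.Closed n (m + 1)

/-- Truth in the standard model `(ℕ, 𝒫(ℕ))`. -/
def Sat : (ℕ → ℕ) → (ℕ → Set ℕ) → Fm → Prop
  | v, _, eq t u => t.eval v = u.eval v
  | v, _, lt t u => t.eval v < u.eval v
  | v, V, mem t X => t.eval v ∈ V X
  | _, _, bot => False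
  | v, V, imp φ ψ => φ.Sat v V → ψ.Sat v V
  | v, V, all φ => ∀ n : ℕ, φ.Sat (cons n v) V
  | v, V, allS φ => ∀ A : Set ℕ, φ.Sat v (cons A V)

def neg (φ : Fm) : Fm := imp φ bot
def or (φ ψ : Fm) : Fm := imp (neg φ) ψ
def and (φ ψ : Fm) : Fm := neg (imp φ (neg ψ))
def iff (φ ψ : Fm) : Fm := and (imp φ ψ) (imp ψ φ)
def ex (φ : Fm) : Fm := neg (all (neg φ))
def exS (φ : Fm) : Fm := neg (allS (neg φ))

/-- Elementary (`Δ⁰₀`) formulas: every quantifier is a bounded number quantifier `∀ x < t` or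
`∃ x < t`, with `x` not in `t`. Set variables may occur free. -/
inductive Delta0 : Fm → Prop
  | eq (t u) : Delta0 (eq t u)
  | lt (t u) : Delta0 (lt t u)
  | mem (t X) : Delta0 (mem t X)
  | bot : Delta0 bot
  | imp {φ ψ} : Delta0 φ → Delta0 ψ → Delta0 (imp φ ψ)
  | ball (t : Tm) {φ} : Delta0 φ → Delta0 (all (.imp (.lt (.var 0) t.lift) φ))
  | bex (t : Tm) {φ} : Delta0 φ → Delta0 (ex (and (.lt (.var 0) t.lift) φ))

/-- `Σ⁰₁` formulas: a block of existential number quantifiers in front of an elementary formula. -/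
inductive Sigma1 : Fm → Prop
  | delta0 {φ} : Delta0 φ → Sigma1 φ
  | ex {φ} : Sigma1 φ → Sigma1 (ex φ)

/-- Arithmetical formulas: no set quantifiers. -/
def Arithmetical : Fm → Prop
  | eq _ _ => True
  | lt _ _ => True
  | mem _ _ => True
  | bot => True
  | imp φ ψ => φ.Arithmetical ∧ ψ.Arithmetical
  | all φ => φ.Arithmetical
  | allS _ => False

end Fm

/-! ## Provability: classical two-sorted predicate logic with equality, by natural deduction -/

/-- `Deriv T Γ φ`: `φ` is derivable from the assumptions `Γ` and the axioms `T`. Free variables of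
the axioms in `T` are read universally. -/
inductive Deriv (T : Set Fm) : List Fm → Fm → Prop
  | ax {Γ φ} : φ ∈ T → Deriv T Γ φ
  | hyp {Γ φ} : φ ∈ Γ → Deriv T Γ φ
  | impI {Γ φ ψ} : Deriv T (φ :: Γ) ψ → Deriv T Γ (.imp φ ψ)
  | impE {Γ φ ψ} : Deriv T Γ (.imp φ ψ) → Deriv T Γ φ → Deriv T Γ ψ
  | raa {Γ φ} : Deriv T (φ.neg :: Γ) .bot → Deriv T Γ φ
  | allI {Γ φ} : Deriv T (Γ.map Fm.lift) φ → Deriv T Γ (.all φ)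
  | allE {Γ φ} (t : Tm) : Deriv T Γ (.all φ) → Deriv T Γ (φ.inst t)
  | allSI {Γ φ} : Deriv T (Γ.map Fm.liftS) φ → Deriv T Γ (.allS φ)
  | allSE {Γ φ} (X : ℕ) : Deriv T Γ (.allS φ) → Deriv T Γ (φ.instS X)
  | eqI {Γ} (t : Tm) : Deriv T Γ (.eq t t)
  | eqE {Γ t u} (φ : Fm) : Deriv T Γ (.eq t u) → Deriv T Γ (φ.inst t) → Deriv T Γ (φ.inst u)

/-- `T ⊢ φ`. -/
def Proves (T : Set Fm) (φ : Fm) : Prop := Deriv T [] φ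

/-! ## Writing formulas with named bound variables

`NT` and `NF` are terms and formulas as functions of the number of number variables in scope. A
variable bound when `d` variables were in scope is the index `e - (d + 1)` when `e` are. -/

abbrev NT := ℕ → Tm
abbrev NF := ℕ → Fm

namespace NF

/-- The variable that was bound when `d` number variables were in scope. -/
def level (d : ℕ) : NT := fun e => .var (e - (d + 1))

def all (f : NT → NF) : NF := fun d => .all (f (level d) (d + 1))
def ex (f : NT → NF) : NF := fun d => .ex (f (level d) (d + 1))
def allS (φ : NF) : NF := fun d => .allS (φ d)
def eq (x y : NT) : NF := fun d => .eq (x d) (y d)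
def lt (x y : NT) : NF := fun d => .lt (x d) (y d)
def mem (x : NT) (X : ℕ) : NF := fun d => .mem (x d) X
def neg (φ : NF) : NF := fun d => (φ d).neg
def imp (φ ψ : NF) : NF := fun d => (φ d).imp (ψ d)
def and (φ ψ : NF) : NF := fun d => (φ d).and (ψ d)
def or (φ ψ : NF) : NF := fun d => (φ d).or (ψ d)
def iff (φ ψ : NF) : NF := fun d => (φ d).iff (ψ d)
/-- `∃ x < t, f x`. -/
def bex (t : NT) (f : NT → NF) : NF := ex fun x => and (lt x t) (f x)
/-- `φ(x)`, for `φ` with free number variable `0`. -/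
def app (φ : Fm) (x : NT) : NF := fun d => φ.subst (fun _ => x d) id
/-- `φ(x, y)`, for `φ` with free number variables `0` and `1`. -/
def app₂ (φ : Fm) (x y : NT) : NF := fun d => φ.subst (cons (x d) fun _ => y d) id
/-- `φ(X, x)`, for `φ` with free set variable `0` and free number variable `0`. -/
def appS (φ : Fm) (X : ℕ) (x : NT) : NF := fun d => φ.subst (fun _ => x d) (fun _ => X)
/-- A closed formula. -/
def sentence (φ : NF) : Fm := φ 0
/-- A formula with one free number variable, which gets index `0`. -/
def formula₁ (f : NT → NF) : Fm := f (level 0) 1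

end NF

infixr:30 "⇒" => NF.imp
infix:29 "⇔" => NF.iff
infixr:35 "⋀" => NF.and
infixr:33 "⋁" => NF.or
infix:50 "≐" => NF.eq
infix:50 "⋖ₙ" => NF.lt
infix:50 "∈ₛ" => NF.mem

/-! ## The theories `ECA₀` and `ACA₀` -/

/-- Defining axioms of the number symbols. -/
def basicAxioms : Set Fm :=
  { NF.sentence (.all fun x => .neg (x + 1 ≐ 0)),
    NF.sentence (.all fun x => .all fun y => x + 1 ≐ y + 1 ⇒ x ≐ y),
    NF.sentence (.all fun x => x + 0 ≐ x),
    NF.sentence (.all fun x => .all fun y => x + (y + 1) ≐ (x + y) + 1),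
    NF.sentence (.all fun x => x * 0 ≐ 0),
    NF.sentence (.all fun x => .all fun y => x * (y + 1) ≐ x * y + x),
    NF.sentence ((fun _ => .exp 0) ≐ 1),
    NF.sentence (.all fun x =>
      (fun d => .exp (x d + 1)) ≐ (fun d => .exp (x d)) + (fun d => .exp (x d))),
    NF.sentence (.all fun x => .neg (x ⋖ₙ 0)),
    NF.sentence (.all fun x => .all fun y => x ⋖ₙ y + 1 ⇔ (x ⋖ₙ y ⋁ x ≐ y)) }

/-- `∀ X (0 ∈ X ∧ ∀ x (x ∈ X → x + 1 ∈ X) → ∀ x (x ∈ X))`. -/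
def setInduction : Fm :=
  NF.sentence (.allS
    ((0 ∈ₛ 0 ⋀ .all fun x => x ∈ₛ 0 ⇒ x + 1 ∈ₛ 0) ⇒ .all fun x => x ∈ₛ 0))

/-- Comprehension for `φ`: `∃ X ∀ x (x ∈ X ↔ φ(x))`, where `x` is number variable `0`, all other
free variables of `φ` are parameters, and `X` is not free in `φ`. -/
def comprehension (φ : Fm) : Fm := .exS (.all (.iff (.mem (.var 0) 0) φ.liftS))

/-- Basic axioms, set induction and elementary comprehension. -/
def ECA₀ : Set Fm := basicAxioms ∪ {setInduction} ∪ {χ | ∃ φ : Fm, φ.Delta0 ∧ χ = comprehension φ}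

/-- Basic axioms, set induction and arithmetical comprehension. -/
def ACA₀ : Set Fm :=
  basicAxioms ∪ {setInduction} ∪ {χ | ∃ φ : Fm, φ.Arithmetical ∧ χ = comprehension φ}

/-- `U` proves every axiom of `T`. -/
def Extends (U T : Set Fm) : Prop := ∀ φ ∈ T, Proves U φ

/-! ## Gödel numbers

The coding functions are polynomials; they are written once and used for numbers, for terms and for
terms in scope. -/

section Coding

variable {A : Type*} [Zero A] [One A] [Add A] [Mul A]

/-- The numeral of `n`: `0̄ = 0` and `(n + 1)‾ = n̄ + 1`. -/
def num : ℕ → A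
  | 0 => 0
  | n + 1 => num n + 1

/-- The (injective) pairing function `⟨x, y⟩ = (x + y)² + x`. -/
def pr (x y : A) : A := (x + y) * (x + y) + x

def cVar (i : A) : A := pr (num 0) i
def cZero : A := pr (num 1) (num 0)
def cOne : A := pr (num 2) (num 0)
def cExp (t : A) : A := pr (num 3) t
def cAdd (t u : A) : A := pr (num 4) (pr t u)
def cMul (t u : A) : A := pr (num 5) (pr t u)

def cEq (t u : A) : A := pr (num 0) (pr t u)
def cLt (t u : A) : A := pr (num 1) (pr t u)
def cMem (t X : A) : A := pr (num 2) (pr t X)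
def cBot : A := pr (num 3) (num 0)
def cImp (φ ψ : A) : A := pr (num 4) (pr φ ψ)
def cAll (φ : A) : A := pr (num 5) φ
def cAllS (φ : A) : A := pr (num 6) φ
def cNeg (φ : A) : A := cImp φ cBot

/-- The code of the result of replacing, in a term below `k` number quantifiers, the `i`-th free
number variable by the closed term with code `c i`. -/
def Tm.quote (c : ℕ → A) (k : ℕ) : Tm → A
  | .var i => if i < k then cVar (num i) else c (i - k)
  | .zero => cZero
  | .one => cOne
  | .exp t => cExp (t.quote c k)
  | .add t u => cAdd (t.quote c k) (u.quote c k)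
  | .mul t u => cMul (t.quote c k) (u.quote c k)

/-- The same for formulas. -/
def Fm.quote (c : ℕ → A) : ℕ → Fm → A
  | k, .eq t u => cEq (t.quote c k) (u.quote c k)
  | k, .lt t u => cLt (t.quote c k) (u.quote c k)
  | k, .mem t X => cMem (t.quote c k) (num X)
  | _, .bot => cBot
  | k, .imp φ ψ => cImp (φ.quote c k) (ψ.quote c k)
  | k, .all φ => cAll (φ.quote c (k + 1))
  | k, .allS φ => cAllS (φ.quote c k)

end Coding

/-- Gödel number of a term. -/
def Tm.code : Tm → ℕ
  | .var i => cVar i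
  | .zero => cZero
  | .one => cOne
  | .exp t => cExp t.code
  | .add t u => cAdd t.code u.code
  | .mul t u => cMul t.code u.code

/-- Gödel number of a formula. -/
def Fm.code : Fm → ℕ
  | .eq t u => cEq t.code u.code
  | .lt t u => cLt t.code u.code
  | .mem t X => cMem t.code X
  | .bot => cBot
  | .imp φ ψ => cImp φ.code ψ.code
  | .all φ => cAll φ.code
  | .allS φ => cAllS φ.code

/-- `B(x)` is a `Σ⁰₁` provability predicate of `U`: a `Σ⁰₁` formula that defines, in the standard
model, the set of Gödel numbers of theorems of `U`. -/
structure IsProvabilityPredicate (U : Set Fm) (B : Fm) : Prop where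
  closed : B.Closed 1 0
  sigma1 : B.Sigma1
  defines : ∀ (n : ℕ) (v : ℕ → ℕ) (V : ℕ → Set ℕ),
    B.Sat (cons n v) V ↔ ∃ φ : Fm, φ.code = n ∧ Proves U φ

/-! ## Arithmetized syntax

A number `s` codes the finite set of the positions of the ones in its binary expansion. The least
set closed under finitely many rules is described as the intersection of all cofinite sets
`{x | x ∉ s}` that are closed under the rules. -/

namespace NF

/-- `x` is not in the finite set coded by `s`: there are no `v < 2 ^ x` and `u ≤ s` with
`s = (2 u + 1) 2 ^ x + v`. -/
def notBit (x s : NT) : NF :=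
  neg (bex (fun d => .exp (x d)) fun v => bex (s + 1) fun u =>
    s ≐ (u + u + 1) * (fun d => .exp (x d)) + v)

/-- `x` is the Gödel number of a term. -/
def isTerm (x : NT) : NF :=
  all fun s =>
    ((all fun i => notBit (cVar i) s) ⋀ notBit cZero s ⋀ notBit cOne s ⋀
      (all fun t => notBit t s ⇒ notBit (cExp t) s) ⋀
      (all fun t => all fun u => notBit t s ⋀ notBit u s ⇒ notBit (cAdd t u) s) ⋀
      (all fun t => all fun u => notBit t s ⋀ notBit u s ⇒ notBit (cMul t u) s)) ⇒
    notBit x s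

/-- `x` is the Gödel number of a formula. -/
def isFormula (x : NT) : NF :=
  all fun s =>
    ((all fun t => all fun u => isTerm t ⋀ isTerm u ⇒ notBit (cEq t u) s) ⋀
      (all fun t => all fun u => isTerm t ⋀ isTerm u ⇒ notBit (cLt t u) s) ⋀
      (all fun t => all fun i => isTerm t ⇒ notBit (cMem t i) s) ⋀
      notBit cBot s ⋀
      (all fun φ => all fun ψ => notBit φ s ⋀ notBit ψ s ⇒ notBit (cImp φ ψ) s) ⋀
      (all fun φ => notBit φ s ⇒ notBit (cAll φ) s) ⋀
      (all fun φ => notBit φ s ⇒ notBit (cAllS φ) s)) ⇒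
    notBit x s

/-- `y` is the Gödel number of the numeral of `x`. -/
def isNumeral (x y : NT) : NF :=
  all fun s =>
    (notBit (pr 0 cZero) s ⋀
      (all fun n => all fun t => notBit (pr n t) s ⇒ notBit (pr (n + 1) (cAdd t cOne)) s)) ⇒
    notBit (pr x y) s

end NF

/-! ## Ordinal notations -/

/-- The representation of `Λ`: an arithmetical formula `fld(x)` for the notations and an
arithmetical formula `lt(x, y)` for the ordering `x ≺ y`, provably transitive. A notation system
for an ordinal is the case in which `≺` well-orders the notations; it is not needed. -/
structure OrdNotation where
  fld : Fm
  lt : Fm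
  fld_closed : fld.Closed 1 0
  lt_closed : lt.Closed 2 0
  fld_arithmetical : fld.Arithmetical
  lt_arithmetical : lt.Arithmetical
  lt_trans : Proves ECA₀ (NF.sentence (.all fun x => .all fun y => .all fun z =>
    NF.app fld x ⋀ NF.app fld y ⋀ NF.app fld z ⇒
      NF.app₂ lt x y ⋀ NF.app₂ lt y z ⇒ NF.app₂ lt x z))

namespace OrdNotation

variable (L : OrdNotation)

/-- `x ≺ y`. -/
def prec (x y : NT) : NF := NF.app₂ L.lt x y

/-- `x ⪯ y`. -/
def preceq (x y : NT) : NF := L.prec x y ⋁ x ≐ y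

/-- `∀ α f(α)`, the quantifier restricted to `Λ`. -/
def all (f : NT → NF) : NF := NF.all fun x => NF.app L.fld x ⇒ f x

/-- `∃ α f(α)`, the quantifier restricted to `Λ`. -/
def ex (f : NT → NF) : NF := NF.ex fun x => NF.app L.fld x ⋀ f x

/-- `wo(α)`: the notations below `α` are strictly linearly ordered by `≺`, and every set that
contains one of them contains a `≺`-least one. -/
def wo (α : NT) : NF :=
  (L.all fun x => L.prec x α ⇒ .neg (L.prec x x)) ⋀
  (L.all fun x => L.all fun y => L.all fun z => L.prec x α ⋀ L.prec y α ⋀ L.prec z α ⇒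
    L.prec x y ⋀ L.prec y z ⇒ L.prec x z) ⋀
  (L.all fun x => L.all fun y => L.prec x α ⋀ L.prec y α ⇒
    L.prec x y ⋁ x ≐ y ⋁ L.prec y x) ⋀
  .allS ((L.ex fun x => L.prec x α ⋀ x ∈ₛ 0) ⇒
    L.ex fun x => L.prec x α ⋀ x ∈ₛ 0 ⋀ L.all fun y => L.prec y α ⋀ y ∈ₛ 0 ⇒ L.preceq x y)

end OrdNotation

/-! ## Iterated one-Münchhausen classes -/

section IMC

variable (L : OrdNotation) (B IMC : Fm)

/-- For a formula `IMC(X, γ)`, the formula `∃ X (IMC(X, x) ∧ ⟨x, y⟩ ∉ X)`, where `x` and `y` are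
number variables `0` and `1`; it says `⟨β⟩ψ` when `x` is `β` and `y` is the code of `¬ψ`. -/
def diamond : Fm := .exS (.and IMC (.neg (.mem (pr (.var 0) (.var 1)) 0)))

/-- `□[∃ X (IMC(X, β̇) ∧ ⟨β̇, ¬ψ̇⟩ ∉ X) → φ]`, where `β`, `ψ`, `φ` are numbers: `b` and `p` are the
Gödel numbers of the numerals of `β` and of (the code of) `¬ψ`. -/
def boxDiamondImp (β ψ φ : NT) : NF :=
  .ex fun b => .ex fun p => NF.isNumeral β b ⋀ NF.isNumeral (cNeg ψ) p ⋀
    NF.app B (cImp ((diamond IMC).quote (cons b fun _ => p) 0) φ)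

/-- The right-hand side of the recursion for `IMC(X, γ)`, for the set variable `X`. -/
def imcStep (X : ℕ) (γ : NT) : NF :=
  L.all fun α => L.preceq α γ ⇒ .all fun φ => NF.isFormula φ ⇒
    (pr α φ ∈ₛ X ⇔
      (NF.app B φ ⋁
        L.ex fun β => L.prec β α ⋀ .ex fun ψ => NF.isFormula ψ ⋀
          .neg (pr β (cNeg ψ) ∈ₛ X) ⋀ boxDiamondImp B IMC β ψ φ))

/-- `IMC(X, γ)` is an iterated one-Münchhausen class predicate for the notations `L` and the
provability predicate `B`: its only free variables are `X` and `γ`, and it satisfies the defining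
recursion provably in `ECA₀`. -/
structure IsIMC : Prop where
  closed : IMC.Closed 1 1
  recursion : Proves ECA₀ (NF.sentence (.allS (L.all fun γ =>
    NF.appS IMC 0 γ ⇔ imcStep L B IMC 0 γ)))

/-- `X ≡_α Y`. -/
def equivUpTo (X Y : ℕ) (α : NT) : NF :=
  L.all fun β => L.preceq β α ⇒ .all fun φ => NF.isFormula φ ⇒
    (pr β φ ∈ₛ X ⇔ pr β φ ∈ₛ Y)

/-- `∃^{≤1} X IMC(X, α)`: `∀ X ∀ Y (IMC(X, α) ∧ IMC(Y, α) → X ≡_α Y)`. -/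
def atMostOneIMC (α : NT) : NF :=
  .allS (.allS ((NF.appS IMC 1 α ⋀ NF.appS IMC 0 α) ⇒ equivUpTo L 1 0 α))

end IMC

end Munchhausen

namespace Munchhausen

/-! ## Substitution -/

/-! Let `X` and `Y` satisfy the recursion up to `α`. At level `x` its right-hand side consults the
set only at pairs whose level is `≺ x`. The boxed formula mentions `IMC` only through a Gödel number
and binds its own set variable, so its truth does not depend on `X` or `Y`. Hence agreement at all
levels `≺ x` gives agreement at `x`. The levels of disagreement form a set by arithmetical
comprehension. If one lay below `α`, `wo(α)` would give a least one; by transitivity its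
predecessors lie below `α` too, so `X` and `Y` agree there and hence at the least level, a
contradiction. One further step settles `α` itself. This is `agree_of_recursion`.

The derivation in `ACA₀` is not written out: by Henkin completeness (`proves_of_holds`) it suffices
to argue in an arbitrary, possibly nonstandard, two-sorted structure satisfying the theorems of
`ACA₀`. The completeness proof needs no new constants: free variables serve as witnesses, and this
requires the axioms to be closed under substitution (`substClosed_ACA₀`). In the structure, the only
fact needed about coded syntax is that formulas are closed under negation (`IsFormula.cNeg`). -/

theorem cons_comp {A C : Type*} (g : A → C) (a : A) (f : ℕ → A) :
    (fun i => g (cons a f i)) = cons (g a) fun i => g (f i) := by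
  funext i; cases i <;> rfl

theorem cons_zero_succ : cons 0 (fun i => i + 1) = id := by
  funext i; cases i <;> rfl

theorem Tm.subst_subst (σ τ : ℕ → Tm) (t : Tm) :
    (t.subst σ).subst τ = t.subst fun i => (σ i).subst τ := by
  induction t <;> simp_all [Tm.subst]

theorem Tm.subst_var (t : Tm) : t.subst .var = t := by
  induction t <;> simp_all [Tm.subst]

theorem Tm.lift_subst_cons (t a : Tm) (τ : ℕ → Tm) : t.lift.subst (cons a τ) = t.subst τ := by
  simp [Tm.lift, Tm.subst_subst, Tm.subst, cons]

theorem Tm.lift_subst (σ : ℕ → Tm) (t : Tm) :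
    t.lift.subst (cons (.var 0) fun i => (σ i).lift) = (t.subst σ).lift := by
  rw [Tm.lift_subst_cons]; simp [Tm.lift, Tm.subst_subst]

namespace Fm

theorem subst_subst (σ τ : ℕ → Tm) (ρ π : ℕ → ℕ) (φ : Fm) :
    (φ.subst σ ρ).subst τ π = φ.subst (fun i => (σ i).subst τ) fun i => π (ρ i) := by
  induction φ generalizing σ τ ρ π with
  | all φ ih =>
    simp only [subst, ih]
    rw [cons_comp fun t : Tm => t.subst (cons (.var 0) fun i => (τ i).lift)]
    simp only [Tm.lift_subst, Tm.subst, cons]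
  | allS φ ih =>
    simp only [subst, ih]
    rw [cons_comp (cons 0 fun i => π i + 1)]
    simp only [cons]
  | _ => simp_all [subst, Tm.subst_subst]

theorem subst_var (φ : Fm) : φ.subst .var id = φ := by
  induction φ with
  | all φ ih =>
    have : (cons (.var 0) fun i => (Tm.var i).lift) = Tm.var := by funext i; cases i <;> rfl
    simp [subst, this, ih]
  | allS φ ih =>
    simp only [subst, id, cons_zero_succ, ih]
  | _ => simp_all [subst, Tm.subst_var]

theorem inst_subst (φ : Fm) (t : Tm) (σ : ℕ → Tm) (ρ : ℕ → ℕ) :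
    (φ.inst t).subst σ ρ =
      (φ.subst (cons (.var 0) fun i => (σ i).lift) ρ).inst (t.subst σ) := by
  simp only [inst, subst_subst]
  rw [cons_comp fun u : Tm => u.subst σ, cons_comp fun u : Tm => u.subst (cons (t.subst σ) .var)]
  simp [Tm.subst, cons, Tm.lift_subst_cons, Tm.subst_var]

theorem instS_subst (φ : Fm) (X : ℕ) (σ : ℕ → Tm) (ρ : ℕ → ℕ) :
    (φ.instS X).subst σ ρ = (φ.subst σ (cons 0 fun i => ρ i + 1)).instS (ρ X) := by
  simp only [instS, subst_subst]
  rw [cons_comp ρ, cons_comp (cons (ρ X) id)]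
  simp [Tm.subst, cons, Tm.subst_var]

theorem subst_inst (φ : Fm) (t : Tm) (σ : ℕ → Tm) (ρ : ℕ → ℕ) :
    (φ.subst (cons (.var 0) fun i => (σ i).lift) ρ).inst t = φ.subst (cons t σ) ρ := by
  simp only [inst, subst_subst]
  rw [cons_comp fun u : Tm => u.subst (cons t .var)]
  simp [Tm.subst, cons, Tm.lift_subst_cons, Tm.subst_var]

theorem subst_instS (φ : Fm) (X : ℕ) (σ : ℕ → Tm) (ρ : ℕ → ℕ) :
    (φ.subst σ (cons 0 fun i => ρ i + 1)).instS X = φ.subst σ (cons X ρ) := by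
  simp only [instS, subst_subst]
  rw [cons_comp (cons X id)]
  simp [cons, Tm.subst_var]

theorem lift_subst (φ : Fm) (σ : ℕ → Tm) (ρ : ℕ → ℕ) :
    φ.lift.subst (cons (.var 0) fun i => (σ i).lift) ρ = (φ.subst σ ρ).lift := by
  simp [lift, subst_subst, Tm.subst, cons, Tm.lift]

theorem liftS_subst (φ : Fm) (σ : ℕ → Tm) (ρ : ℕ → ℕ) :
    φ.liftS.subst σ (cons 0 fun i => ρ i + 1) = (φ.subst σ ρ).liftS := by
  simp [liftS, subst_subst, Tm.subst, cons, Tm.subst_var]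

end Fm

theorem Tm.Closed.mono {t : Tm} {n n' : ℕ} (h : t.Closed n) (hn : n ≤ n') : t.Closed n' := by
  induction t with
  | var i => exact lt_of_lt_of_le h hn
  | _ => simp_all [Tm.Closed]

theorem Tm.exists_closed (t : Tm) : ∃ n, t.Closed n := by
  induction t with
  | var i => exact ⟨i + 1, Nat.lt_succ_self i⟩
  | zero => exact ⟨0, trivial⟩
  | one => exact ⟨0, trivial⟩
  | exp t ih => exact ih
  | add t u iht ihu =>
    obtain ⟨a, ha⟩ := iht; obtain ⟨b, hb⟩ := ihu
    exact ⟨max a b, ha.mono (le_max_left _ _), hb.mono (le_max_right _ _)⟩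
  | mul t u iht ihu =>
    obtain ⟨a, ha⟩ := iht; obtain ⟨b, hb⟩ := ihu
    exact ⟨max a b, ha.mono (le_max_left _ _), hb.mono (le_max_right _ _)⟩

theorem Tm.Closed.subst_congr {t : Tm} {n : ℕ} (h : t.Closed n) {σ τ : ℕ → Tm}
    (hσ : ∀ i < n, σ i = τ i) : t.subst σ = t.subst τ := by
  induction t with
  | var i => exact hσ i h
  | _ => simp_all [Tm.Closed, Tm.subst]

theorem Fm.Closed.mono {φ : Fm} {n n' m m' : ℕ} (h : φ.Closed n m) (hn : n ≤ n')
    (hm : m ≤ m') : φ.Closed n' m' := by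
  induction φ generalizing n n' m m' with
  | eq t u => exact ⟨h.1.mono hn, h.2.mono hn⟩
  | lt t u => exact ⟨h.1.mono hn, h.2.mono hn⟩
  | mem t X => exact ⟨h.1.mono hn, h.2.trans_le hm⟩
  | bot => trivial
  | imp φ ψ ihφ ihψ => exact ⟨ihφ h.1 hn hm, ihψ h.2 hn hm⟩
  | all φ ih => exact ih (n := n + 1) h (by omega) hm
  | allS φ ih => exact ih (m := m + 1) h hn (by omega)

theorem Fm.exists_closed (φ : Fm) : ∃ n, φ.Closed n n := by
  induction φ with
  | eq t u =>
    obtain ⟨a, ha⟩ := t.exists_closed; obtain ⟨b, hb⟩ := u.exists_closed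
    exact ⟨max a b, ha.mono (le_max_left _ _), hb.mono (le_max_right _ _)⟩
  | lt t u =>
    obtain ⟨a, ha⟩ := t.exists_closed; obtain ⟨b, hb⟩ := u.exists_closed
    exact ⟨max a b, ha.mono (le_max_left _ _), hb.mono (le_max_right _ _)⟩
  | mem t X =>
    obtain ⟨a, ha⟩ := t.exists_closed
    exact ⟨max a (X + 1), ha.mono (le_max_left _ _), lt_of_lt_of_le X.lt_succ_self
      (le_max_right _ _)⟩
  | bot => exact ⟨0, trivial⟩
  | imp φ ψ ihφ ihψ =>
    obtain ⟨a, ha⟩ := ihφ; obtain ⟨b, hb⟩ := ihψ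
    exact ⟨max a b, ha.mono (le_max_left _ _) (le_max_left _ _),
      hb.mono (le_max_right _ _) (le_max_right _ _)⟩
  | all φ ih => obtain ⟨a, ha⟩ := ih; exact ⟨a, ha.mono (n' := a + 1) (Nat.le_succ a) le_rfl⟩
  | allS φ ih => obtain ⟨a, ha⟩ := ih; exact ⟨a, ha.mono (m' := a + 1) le_rfl (Nat.le_succ a)⟩

/-- Contexts are finite, so a variable fresh for the whole context always exists. The axioms may use
every variable; that is harmless when they are closed under substitution. -/
theorem exists_closed_of_list (Γ : List Fm) : ∃ n, ∀ φ ∈ Γ, φ.Closed n n := by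
  induction Γ with
  | nil => exact ⟨0, by simp⟩
  | cons φ Γ ih =>
    obtain ⟨a, ha⟩ := ih
    obtain ⟨b, hb⟩ := φ.exists_closed
    refine ⟨max a b, List.forall_mem_cons.2 ⟨?_, fun ψ hψ => ?_⟩⟩
    · exact hb.mono (le_max_right _ _) (le_max_right _ _)
    · exact (ha ψ hψ).mono (le_max_left _ _) (le_max_left _ _)

theorem Fm.Closed.subst_congr {φ : Fm} {n m : ℕ} (h : φ.Closed n m) {σ τ : ℕ → Tm}
    {ρ π : ℕ → ℕ} (hσ : ∀ i < n, σ i = τ i) (hρ : ∀ i < m, ρ i = π i) :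
    φ.subst σ ρ = φ.subst τ π := by
  induction φ generalizing n m σ τ ρ π with
  | eq t u => simp only [Fm.subst, h.1.subst_congr hσ, h.2.subst_congr hσ]
  | lt t u => simp only [Fm.subst, h.1.subst_congr hσ, h.2.subst_congr hσ]
  | mem t X => simp only [Fm.subst, h.1.subst_congr hσ, hρ X h.2]
  | bot => rfl
  | imp φ ψ ihφ ihψ => simp only [Fm.subst, ihφ h.1 hσ hρ, ihψ h.2 hσ hρ]
  | all φ ih =>
    refine congrArg Fm.all (ih (n := n + 1) h (fun i hi => ?_) hρ)
    cases i with
    | zero => rfl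
    | succ i => simp only [cons, hσ i (by omega)]
  | allS φ ih =>
    refine congrArg Fm.allS (ih (m := m + 1) h hσ fun i hi => ?_)
    cases i with
    | zero => rfl
    | succ i => simp only [cons, hρ i (by omega)]

/-! ## Structural properties of derivations -/

/-- A set of axioms is closed under substitution for free variables. -/
def SubstClosed (T : Set Fm) : Prop :=
  ∀ φ ∈ T, ∀ (σ : ℕ → Tm) (ρ : ℕ → ℕ), φ.subst σ ρ ∈ T

namespace Deriv

variable {T : Set Fm} {Γ Δ : List Fm} {φ ψ χ : Fm}

theorem weaken (h : Deriv T Γ φ) (hΓ : Γ ⊆ Δ) : Deriv T Δ φ := by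
  induction h generalizing Δ with
  | ax h => exact ax h
  | hyp h => exact hyp (hΓ h)
  | impI _ ih => exact impI (ih (List.cons_subset_cons _ hΓ))
  | impE _ _ ih₁ ih₂ => exact impE (ih₁ hΓ) (ih₂ hΓ)
  | raa _ ih => exact raa (ih (List.cons_subset_cons _ hΓ))
  | allI _ ih => exact allI (ih (List.map_subset _ hΓ))
  | allE t _ ih => exact allE t (ih hΓ)
  | allSI _ ih => exact allSI (ih (List.map_subset _ hΓ))
  | allSE X _ ih => exact allSE X (ih hΓ)
  | eqI t => exact eqI t
  | eqE φ _ _ ih₁ ih₂ => exact eqE φ (ih₁ hΓ) (ih₂ hΓ)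

theorem mono {S : Set Fm} (hTS : T ⊆ S) (h : Deriv T Γ φ) : Deriv S Γ φ := by
  induction h with
  | ax h => exact ax (hTS h)
  | hyp h => exact hyp h
  | impI _ ih => exact impI ih
  | impE _ _ ih₁ ih₂ => exact impE ih₁ ih₂
  | raa _ ih => exact raa ih
  | allI _ ih => exact allI ih
  | allE t _ ih => exact allE t ih
  | allSI _ ih => exact allSI ih
  | allSE X _ ih => exact allSE X ih
  | eqI t => exact eqI t
  | eqE φ _ _ ih₁ ih₂ => exact eqE φ ih₁ ih₂

/-- Serves twice: to rename a fresh variable to a bound one, and to show that theorems hold under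
every valuation of the term model. -/
theorem subst (hT : SubstClosed T) (h : Deriv T Γ φ) (σ : ℕ → Tm) (ρ : ℕ → ℕ) :
    Deriv T (Γ.map (Fm.subst σ ρ)) (φ.subst σ ρ) := by
  induction h generalizing σ ρ with
  | ax h => exact ax (hT _ h σ ρ)
  | hyp h => exact hyp (List.mem_map_of_mem h)
  | impI _ ih => exact impI (ih σ ρ)
  | impE _ _ ih₁ ih₂ => exact impE (ih₁ σ ρ) (ih₂ σ ρ)
  | raa _ ih => exact raa (ih σ ρ)
  | allI _ ih =>
    refine allI ?_
    have := ih (cons (.var 0) fun i => (σ i).lift) ρ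
    simpa only [List.map_map, Function.comp_def, Fm.lift_subst] using this
  | allE t _ ih => rw [Fm.inst_subst]; exact allE _ (ih σ ρ)
  | allSI _ ih =>
    refine allSI ?_
    have := ih σ (cons 0 fun i => ρ i + 1)
    simpa only [List.map_map, Function.comp_def, Fm.liftS_subst] using this
  | allSE X _ ih => rw [Fm.instS_subst]; exact allSE _ (ih σ ρ)
  | eqI t => exact eqI _
  | eqE φ _ _ ih₁ ih₂ =>
    rw [Fm.inst_subst]
    refine eqE _ (ih₁ σ ρ) ?_
    rw [← Fm.inst_subst]
    exact ih₂ σ ρ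

theorem botE (h : Deriv T Γ .bot) : Deriv T Γ φ :=
  raa (h.weaken (List.subset_cons_self _ _))

theorem hyp₀ : Deriv T (φ :: Γ) φ := hyp (by simp)

theorem hyp₁ : Deriv T (ψ :: φ :: Γ) φ := hyp (by simp)

/-- Universal generalization on a variable that does not occur free. -/
theorem all_of_fresh (hT : SubstClosed T) {k : ℕ} (hΓ : ∀ ψ ∈ Γ, ψ.Closed k k)
    (hφ : (Fm.all φ).Closed k k) (h : Deriv T Γ (φ.inst (.var k))) : Deriv T Γ (.all φ) := by
  refine allI ?_
  -- The renaming sends the fresh variable `k` to the index about to be bound and shifts all others.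
  -- On `Γ`, where `k` does not occur, it is `Fm.lift`; on the instance at `k` it undoes the
  -- instantiation.
  have h' := h.subst hT (fun i => if i = k then .var 0 else .var (i + 1)) id
  have e₁ : Γ.map (Fm.subst (fun i => if i = k then .var 0 else .var (i + 1)) id) =
      Γ.map Fm.lift :=
    List.map_congr_left fun ψ hψ =>
      (hΓ ψ hψ).subst_congr (fun i hi => if_neg hi.ne) fun _ _ => rfl
  have e₂ : (φ.inst (.var k)).subst (fun i => if i = k then .var 0 else .var (i + 1)) id = φ := by
    rw [Fm.inst, Fm.subst_subst]
    refine Eq.trans (Fm.Closed.subst_congr (n := k + 1) (m := k) hφ (fun i hi => ?_)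
      fun _ _ => rfl) φ.subst_var
    cases i with
    | zero => simp [cons, Tm.subst]
    | succ i => simp only [cons, Tm.subst]; exact if_neg (by omega)
  rwa [e₁, e₂] at h'

/-- Universal generalization on a set variable that does not occur free. -/
theorem allS_of_fresh (hT : SubstClosed T) {k : ℕ} (hΓ : ∀ ψ ∈ Γ, ψ.Closed k k)
    (hφ : (Fm.allS φ).Closed k k) (h : Deriv T Γ (φ.instS k)) : Deriv T Γ (.allS φ) := by
  refine allSI ?_
  have h' := h.subst hT .var (fun i => if i = k then 0 else i + 1)
  have e₁ : Γ.map (Fm.subst .var (fun i => if i = k then 0 else i + 1)) = Γ.map Fm.liftS :=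
    List.map_congr_left fun ψ hψ =>
      (hΓ ψ hψ).subst_congr (fun _ _ => rfl) fun i hi => if_neg hi.ne
  have e₂ : (φ.instS k).subst .var (fun i => if i = k then 0 else i + 1) = φ := by
    rw [Fm.instS, Fm.subst_subst]
    refine Eq.trans (Fm.Closed.subst_congr (n := k) (m := k + 1) hφ (fun i hi => rfl)
      fun i hi => ?_) φ.subst_var
    cases i with
    | zero => simp [cons]
    | succ i => simp only [cons, id]; exact if_neg (by omega)
  rwa [e₁, e₂] at h'

end Deriv

/-! ## Countability of the language -/

/-- With `s = x + y` the code is `s² + x`, where `x ≤ s`; it lies strictly below `(s + 1)²`, so it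
determines `s` and then `x`. -/
theorem pr_inj {x y x' y' : ℕ} : pr x y = pr x' y' ↔ x = x' ∧ y = y' := by
  refine ⟨fun h => ?_, fun h => by rw [h.1, h.2]⟩
  simp only [pr] at h
  have hs : x + y = x' + y' := by
    rcases lt_trichotomy (x + y) (x' + y') with h' | h' | h'
    · nlinarith
    · exact h'
    · nlinarith
  rw [hs] at h
  omega

theorem Tm.code_injective : Function.Injective Tm.code := by
  intro t
  induction t with
  | _ =>
    intro u h
    cases u <;>
      simp_all [Tm.code, cVar, cZero, cOne, cExp, cAdd, cMul, pr_inj, num] <;>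
      grind

theorem Fm.code_injective : Function.Injective Fm.code := by
  intro φ
  induction φ with
  | _ =>
    intro u h
    cases u <;>
      simp_all [Fm.code, cEq, cLt, cMem, cBot, cImp, cAll, cAllS, pr_inj, num,
        Tm.code_injective.eq_iff] <;> grind

instance : Countable Fm := Fm.code_injective.countable

instance : Nonempty Fm := ⟨.bot⟩

/-! ## Complete Henkin theories -/

section Henkin

variable {T : Set Fm}

/-- A consistent, complete, deductively closed set of formulas in which every universal formula all
of whose instances are members is a member. -/
structure IsHenkin (T : Set Fm) (H : Set Fm) : Prop where
  not_bot : Fm.bot ∉ H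
  of_proves {φ : Fm} : Proves T φ → φ ∈ H
  mp {φ ψ : Fm} : φ.imp ψ ∈ H → φ ∈ H → ψ ∈ H
  complete (φ : Fm) : φ ∈ H ∨ φ.neg ∈ H
  all {φ : Fm} : (∀ t, φ.inst t ∈ H) → φ.all ∈ H
  allS {φ : Fm} : (∀ X, φ.instS X ∈ H) → φ.allS ∈ H

/-- One Lindenbaum–Henkin stage. If `ψ` is consistent with `Γ`, it is added. Otherwise `ψ.neg` is
added, and for a universal `ψ` also the negation of its instance at a fresh variable, as a
counterexample. -/
theorem exists_consistent_step (hT : SubstClosed T) (Γ : List Fm) (hΓ : ¬ Deriv T Γ .bot)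
    (ψ : Fm) :
    ∃ Δ : List Fm, ¬ Deriv T Δ .bot ∧ Γ ⊆ Δ ∧ (ψ ∈ Δ ∨ ψ.neg ∈ Δ) ∧
      (∀ χ, ψ = .all χ → ψ ∈ Δ ∨ ∃ t, (χ.inst t).neg ∈ Δ) ∧
      (∀ χ, ψ = .allS χ → ψ ∈ Δ ∨ ∃ X, (χ.instS X).neg ∈ Δ) := by
  by_cases h : Deriv T (ψ :: Γ) .bot
  · have hn : ¬ Deriv T Γ ψ := fun hψ => hΓ (.impE (.impI h) hψ)
    obtain ⟨k, hk⟩ := exists_closed_of_list (ψ :: Γ)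
    rw [List.forall_mem_cons] at hk
    -- Since `Γ` refutes `ψ`, an inconsistency of both negations would make `Γ` prove `θ`, hence
    -- `ψ`. For `θ` the fresh instance, the passage from `θ` to `ψ` is universal generalization.
    have key (θ : Fm) (hθ : Deriv T Γ θ → Deriv T Γ ψ) :
        ¬ Deriv T (ψ.neg :: θ.neg :: Γ) .bot := by
      intro hd
      have h₁ : Deriv T (θ.neg :: Γ) ψ := .raa hd
      have h₂ : Deriv T (θ.neg :: Γ) .bot :=
        .impE (Deriv.weaken (.impI h) (List.subset_cons_self _ _)) h₁
      exact hn (hθ (.raa h₂))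
    cases ψ with
    | all χ =>
      refine ⟨_, key _ (Deriv.all_of_fresh hT hk.2 hk.1), ?_, by simp, ?_, by simp⟩
      · exact fun x hx => by simp [hx]
      · rintro _ ⟨⟩; exact Or.inr ⟨.var k, by simp⟩
    | allS χ =>
      refine ⟨_, key _ (Deriv.allS_of_fresh hT hk.2 hk.1), ?_, by simp, by simp, ?_⟩
      · exact fun x hx => by simp [hx]
      · rintro _ ⟨⟩; exact Or.inr ⟨k, by simp⟩
    | _ =>
      exact ⟨_, fun hd => hn (.raa hd), List.subset_cons_self _ _, by simp, by simp, by simp⟩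
  · exact ⟨_, h, List.subset_cons_self _ _, by simp, by simp, by simp⟩

theorem exists_isHenkin (hT : SubstClosed T) {φ : Fm} (hφ : ¬ Proves T φ) :
    ∃ H, IsHenkin T H ∧ φ ∉ H := by
  obtain ⟨e, he⟩ := exists_surjective_nat Fm
  choose step hcons hsub hcompl hall hallS using
    fun (Γ : {Γ : List Fm // ¬ Deriv T Γ .bot}) => exists_consistent_step hT Γ.1 Γ.2
  let G : ℕ → {Γ : List Fm // ¬ Deriv T Γ .bot} := fun n =>
    Nat.rec ⟨[φ.neg], fun h => hφ (.raa h)⟩ (fun n Γ => ⟨step Γ (e n), hcons Γ (e n)⟩) n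
  have hG : ∀ n, (G (n + 1)).1 = step (G n) (e n) := fun n => rfl
  have hmono : ∀ m n, m ≤ n → (G m).1 ⊆ (G n).1 := by
    intro m n hmn
    induction n, hmn using Nat.le_induction with
    | base => exact List.Subset.refl _
    | succ n _ ih => exact List.Subset.trans ih (hsub (G n) (e n))
  -- The stages are nested and consistent, so a formula whose negation has entered at some stage is
  -- derivable at none. This excludes `φ` from the limit, and it shows that a universal formula was
  -- not rejected when all its instances are derivable.
  have hneg : ∀ {n ψ}, ψ.neg ∈ (G n).1 → ∀ m, ¬ Deriv T (G m).1 ψ := by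
    intro n ψ h m hd
    refine (G (max m n)).2 (.impE (.hyp (hmono n _ (le_max_right _ _) h))
      (hd.weaken (hmono m _ (le_max_left _ _))))
  refine ⟨{ψ | ∃ n, Deriv T (G n).1 ψ}, ⟨?_, ?_, ?_, ?_, ?_, ?_⟩, ?_⟩
  · rintro ⟨n, hn⟩; exact (G n).2 hn
  · exact fun h => ⟨0, h.weaken (List.nil_subset _)⟩
  · rintro ψ χ ⟨m, hm⟩ ⟨n, hn⟩
    exact ⟨max m n, .impE (hm.weaken (hmono m _ (le_max_left _ _)))
      (hn.weaken (hmono n _ (le_max_right _ _)))⟩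
  · intro ψ
    obtain ⟨n, rfl⟩ := he ψ
    exact (hcompl (G n) (e n)).imp (fun h => ⟨n + 1, .hyp h⟩) fun h => ⟨n + 1, .hyp h⟩
  · intro χ h
    obtain ⟨n, hn⟩ := he (.all χ)
    rcases hall (G n) (e n) χ hn with h' | ⟨t, ht⟩
    · exact ⟨n + 1, .hyp (hn ▸ h')⟩
    · obtain ⟨m, hm⟩ := h t
      exact absurd hm (hneg (n := n + 1) ht m)
  · intro χ h
    obtain ⟨n, hn⟩ := he (.allS χ)
    rcases hallS (G n) (e n) χ hn with h' | ⟨t, ht⟩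
    · exact ⟨n + 1, .hyp (hn ▸ h')⟩
    · obtain ⟨m, hm⟩ := h t
      exact absurd hm (hneg (n := n + 1) ht m)
  · rintro ⟨n, hn⟩
    exact hneg (n := 0) (List.mem_singleton.2 rfl) n hn

end Henkin

/-! ## General models and completeness -/

/-- A structure for the language of second order arithmetic, with numbers `N` and sets `S`. -/
class Interp (N : Type) (S : outParam Type) extends Zero N, One N, Add N, Mul N where
  exp : N → N
  lt : N → N → Prop
  mem : N → S → Prop

section Interp

variable {N S : Type} [Interp N S]

/-- The value of a term in a structure. -/
def Tm.val (v : ℕ → N) : Tm → N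
  | .var i => v i
  | .zero => 0
  | .one => 1
  | .exp t => Interp.exp (t.val v)
  | .add t u => t.val v + u.val v
  | .mul t u => t.val v * u.val v

/-- Truth in a structure. -/
def Fm.Holds : (ℕ → N) → (ℕ → S) → Fm → Prop
  | v, _, eq t u => t.val v = u.val v
  | v, _, lt t u => Interp.lt (t.val v) (u.val v)
  | v, V, mem t X => Interp.mem (t.val v) (V X)
  | _, _, bot => False
  | v, V, imp φ ψ => φ.Holds v V → ψ.Holds v V
  | v, V, all φ => ∀ n : N, φ.Holds (cons n v) V
  | v, V, allS φ => ∀ A : S, φ.Holds v (cons A V)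

theorem Tm.val_subst (v : ℕ → N) (σ : ℕ → Tm) (t : Tm) :
    (t.subst σ).val v = t.val fun i => (σ i).val v := by
  induction t <;> simp_all [Tm.subst, Tm.val]

theorem Tm.val_lift_cons (n : N) (v : ℕ → N) (t : Tm) : t.lift.val (cons n v) = t.val v := by
  simp [Tm.lift, Tm.val_subst, Tm.val, cons]

theorem Fm.holds_subst (v : ℕ → N) (V : ℕ → S) (σ : ℕ → Tm) (ρ : ℕ → ℕ) (φ : Fm) :
    (φ.subst σ ρ).Holds v V ↔ φ.Holds (fun i => (σ i).val v) fun i => V (ρ i) := by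
  induction φ generalizing v V σ ρ with
  | all φ ih =>
    simp only [Fm.subst, Fm.Holds, ih]
    refine forall_congr' fun n => ?_
    rw [cons_comp (Tm.val (cons n v))]
    simp only [Tm.val_lift_cons, Tm.val, cons]
  | allS φ ih =>
    simp only [Fm.subst, Fm.Holds, ih]
    refine forall_congr' fun A => ?_
    rw [cons_comp (cons A V)]
    simp only [cons]
  | _ => simp_all [Fm.subst, Fm.Holds, Tm.val_subst]

/-- Used with `m = 0`: the truth of the formulas for `Λ`, `≺` and provability is unaffected by the
sets placed in the valuation. -/
theorem Fm.Closed.holds_congr {φ : Fm} {n m : ℕ} (h : φ.Closed n m) (v : ℕ → N) {V W : ℕ → S}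
    (hV : ∀ i < m, V i = W i) : φ.Holds v V ↔ φ.Holds v W := by
  induction φ generalizing n m v V W with
  | eq t u => rfl
  | lt t u => rfl
  | mem t X => simp only [Fm.Holds, hV X h.2]
  | bot => rfl
  | imp φ ψ ihφ ihψ => exact imp_congr (ihφ h.1 v hV) (ihψ h.2 v hV)
  | all φ ih => exact forall_congr' fun a => ih (n := n + 1) h _ hV
  | allS φ ih =>
    refine forall_congr' fun A => ih (m := m + 1) h _ fun i hi => ?_
    cases i with
    | zero => rfl
    | succ i => exact hV i (by omega)

end Interp

namespace IsHenkin

variable {T H : Set Fm}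

theorem mp₂ (hH : IsHenkin T H) {φ ψ χ : Fm} (h : Proves T (φ.imp (ψ.imp χ))) (h₁ : φ ∈ H)
    (h₂ : ψ ∈ H) : χ ∈ H :=
  hH.mp (hH.mp (hH.of_proves h) h₁) h₂

theorem imp_mem (hH : IsHenkin T H) {φ ψ : Fm} : φ.imp ψ ∈ H ↔ (φ ∈ H → ψ ∈ H) := by
  refine ⟨hH.mp, fun h => ?_⟩
  rcases hH.complete φ with h' | h'
  · exact hH.mp (hH.of_proves (.impI (.impI .hyp₁))) (h h')
  · exact hH.mp (hH.of_proves (.impI (.impI (.botE (.impE .hyp₁ .hyp₀))))) h'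

theorem all_mem (hH : IsHenkin T H) {φ : Fm} : φ.all ∈ H ↔ ∀ t, φ.inst t ∈ H :=
  ⟨fun h t => hH.mp (hH.of_proves (.impI (.allE t .hyp₀))) h, hH.all⟩

theorem allS_mem (hH : IsHenkin T H) {φ : Fm} : φ.allS ∈ H ↔ ∀ X, φ.instS X ∈ H :=
  ⟨fun h X => hH.mp (hH.of_proves (.impI (.allSE X .hyp₀))) h, hH.allS⟩

theorem eq_refl (hH : IsHenkin T H) (t : Tm) : Fm.eq t t ∈ H := hH.of_proves (.eqI t)

theorem inst_congr (hH : IsHenkin T H) (φ : Fm) {t u : Tm} (h : Fm.eq t u ∈ H)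
    (ht : φ.inst t ∈ H) : φ.inst u ∈ H :=
  hH.mp₂ (.impI (.impI (.eqE φ .hyp₁ .hyp₀))) h ht

theorem eq_symm (hH : IsHenkin T H) {t u : Tm} (h : Fm.eq t u ∈ H) : Fm.eq u t ∈ H := by
  -- Leibniz's rule for the context `x = t`, starting from `t = t`.
  have := hH.inst_congr (.eq (.var 0) t.lift) h
  simp only [Fm.inst, Fm.subst, Tm.lift_subst_cons, Tm.subst_var, Tm.subst, cons] at this
  exact this (hH.eq_refl t)

theorem eq_trans (hH : IsHenkin T H) {t u w : Tm} (h : Fm.eq t u ∈ H) (h' : Fm.eq u w ∈ H) :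
    Fm.eq t w ∈ H := by
  have := hH.inst_congr (.eq t.lift (.var 0)) h'
  simp only [Fm.inst, Fm.subst, Tm.lift_subst_cons, Tm.subst_var, Tm.subst, cons] at this
  exact this h

/-- Provable equality respects every context with one hole. -/
theorem eq_congr (hH : IsHenkin T H) (c : Tm) {t u : Tm} (h : Fm.eq t u ∈ H) :
    Fm.eq (c.subst (cons t .var)) (c.subst (cons u .var)) ∈ H := by
  have := hH.inst_congr (.eq (c.subst (cons t .var)).lift c) h
  simp only [Fm.inst, Fm.subst, Tm.lift_subst_cons, Tm.subst_var] at this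
  exact this (hH.eq_refl _)

/-- Equality in a complete Henkin theory. -/
def setoid (hH : IsHenkin T H) : Setoid Tm where
  r t u := Fm.eq t u ∈ H
  iseqv := ⟨hH.eq_refl, hH.eq_symm, hH.eq_trans⟩

theorem exp_congr (hH : IsHenkin T H) {t t' : Tm} (h : Fm.eq t t' ∈ H) :
    Fm.eq t.exp t'.exp ∈ H := by
  simpa only [Tm.subst, cons] using hH.eq_congr (.exp (.var 0)) h

theorem add_congr (hH : IsHenkin T H) {t t' u u' : Tm} (h : Fm.eq t t' ∈ H)
    (h' : Fm.eq u u' ∈ H) : Fm.eq (t.add u) (t'.add u') ∈ H := by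
  have h₁ := hH.eq_congr (.add (.var 0) u.lift) h
  have h₂ := hH.eq_congr (.add t'.lift (.var 0)) h'
  simp only [Tm.subst, cons, Tm.lift_subst_cons, Tm.subst_var] at h₁ h₂
  exact hH.eq_trans h₁ h₂

theorem mul_congr (hH : IsHenkin T H) {t t' u u' : Tm} (h : Fm.eq t t' ∈ H)
    (h' : Fm.eq u u' ∈ H) : Fm.eq (t.mul u) (t'.mul u') ∈ H := by
  have h₁ := hH.eq_congr (.mul (.var 0) u.lift) h
  have h₂ := hH.eq_congr (.mul t'.lift (.var 0)) h'
  simp only [Tm.subst, cons, Tm.lift_subst_cons, Tm.subst_var] at h₁ h₂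
  exact hH.eq_trans h₁ h₂

theorem lt_congr (hH : IsHenkin T H) {t t' u u' : Tm} (h : Fm.eq t t' ∈ H)
    (h' : Fm.eq u u' ∈ H) (hl : Fm.lt t u ∈ H) : Fm.lt t' u' ∈ H := by
  have h₁ := hH.inst_congr (.lt (.var 0) u.lift) h
  have h₂ := hH.inst_congr (.lt t'.lift (.var 0)) h'
  simp only [Fm.inst, Fm.subst, Tm.subst, cons, Tm.lift_subst_cons, Tm.subst_var] at h₁ h₂
  exact h₂ (h₁ hl)

theorem mem_congr (hH : IsHenkin T H) {t t' : Tm} (X : ℕ) (h : Fm.eq t t' ∈ H)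
    (hm : Fm.mem t X ∈ H) : Fm.mem t' X ∈ H := by
  have := hH.inst_congr (.mem (.var 0) X) h
  simp only [Fm.inst, Fm.subst, Tm.subst, cons, id] at this
  exact this hm

/-- The term model of a complete Henkin theory. -/
@[reducible] def termModel (hH : IsHenkin T H) : Interp (Quotient hH.setoid) ℕ where
  zero := Quotient.mk _ .zero
  one := Quotient.mk _ .one
  add := Quotient.map₂ Tm.add fun _ _ h _ _ h' => hH.add_congr h h'
  mul := Quotient.map₂ Tm.mul fun _ _ h _ _ h' => hH.mul_congr h h'
  exp := Quotient.map Tm.exp fun _ _ h => hH.exp_congr h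
  lt := Quotient.lift₂ (fun t u => Fm.lt t u ∈ H) fun _ _ _ _ h h' =>
    propext ⟨hH.lt_congr h h', hH.lt_congr (hH.eq_symm h) (hH.eq_symm h')⟩
  mem q X := Quotient.lift (fun t => Fm.mem t X ∈ H) (fun _ _ h =>
    propext ⟨hH.mem_congr X h, hH.mem_congr X (hH.eq_symm h)⟩) q

theorem val_termModel (hH : IsHenkin T H) (σ : ℕ → Tm) (t : Tm) :
    letI := hH.termModel
    t.val (fun i => Quotient.mk hH.setoid (σ i)) = Quotient.mk hH.setoid (t.subst σ) := by
  let := hH.termModel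
  induction t with
  | var i => rfl
  | zero => rfl
  | one => rfl
  | exp t ih => simp only [Tm.val, ih]; rfl
  | add t u iht ihu => simp only [Tm.val, iht, ihu]; rfl
  | mul t u iht ihu => simp only [Tm.val, iht, ihu]; rfl

/-- The truth lemma. Number quantifiers range over classes of terms and set quantifiers over set
variables, so these cases are the Henkin properties `all_mem` and `allS_mem`. Sets need no quotient,
as the language has no equality between them. -/
theorem holds_termModel (hH : IsHenkin T H) (σ : ℕ → Tm) (ρ : ℕ → ℕ) (φ : Fm) :
    letI := hH.termModel
    φ.Holds (fun i => Quotient.mk hH.setoid (σ i)) ρ ↔ φ.subst σ ρ ∈ H := by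
  let := hH.termModel
  induction φ generalizing σ ρ with
  | eq t u =>
    simp only [Fm.Holds, hH.val_termModel, Fm.subst]
    exact Quotient.eq
  | lt t u => simp only [Fm.Holds, hH.val_termModel, Fm.subst]; rfl
  | mem t X => simp only [Fm.Holds, hH.val_termModel, Fm.subst]; rfl
  | bot => exact iff_of_false id hH.not_bot
  | imp φ ψ ihφ ihψ => simp only [Fm.Holds, Fm.subst, hH.imp_mem, ihφ, ihψ]
  | all φ ih =>
    simp only [Fm.Holds, Fm.subst, hH.all_mem, Fm.subst_inst]
    rw [Quotient.mk_surjective.forall]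
    refine forall_congr' fun t => ?_
    rw [← cons_comp (Quotient.mk hH.setoid)]
    exact ih _ _
  | allS φ ih =>
    simp only [Fm.Holds, Fm.subst, hH.allS_mem, Fm.subst_instS, ih]

end IsHenkin

/-- Completeness: a formula that holds in every structure in which the theorems of `T` hold is a
theorem of `T`. -/
theorem proves_of_holds {T : Set Fm} (hT : SubstClosed T) {φ : Fm}
    (h : ∀ (N S : Type) [Interp N S],
      (∀ ψ, Proves T ψ → ∀ (v : ℕ → N) (V : ℕ → S), ψ.Holds v V) →
      ∀ (v : ℕ → N) (V : ℕ → S), φ.Holds v V) : Proves T φ := by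
  by_contra hφ
  obtain ⟨H, hH, hφH⟩ := exists_isHenkin hT hφ
  let := hH.termModel
  refine hφH ?_
  -- Membership in `H` is truth under the valuation sending each variable to itself.
  rw [← φ.subst_var, ← hH.holds_termModel]
  refine h _ _ (fun ψ hψ v V => ?_) _ _
  -- Choosing representatives turns an arbitrary valuation into a substitution, under which theorems
  -- remain theorems and so lie in `H`.
  obtain ⟨σ, rfl⟩ : ∃ σ : ℕ → Tm, (fun i => Quotient.mk hH.setoid (σ i)) = v :=
    ⟨fun i => (v i).out, funext fun i => (v i).out_eq⟩
  rw [hH.holds_termModel]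
  exact hH.of_proves (hψ.subst hT σ V)

/-! ## Closure of `ACA₀` under substitution -/

theorem Fm.Arithmetical.subst {φ : Fm} (h : φ.Arithmetical) (σ : ℕ → Tm) (ρ : ℕ → ℕ) :
    (φ.subst σ ρ).Arithmetical := by
  induction φ generalizing σ ρ with
  | imp φ ψ ihφ ihψ => exact ⟨ihφ h.1 σ ρ, ihψ h.2 σ ρ⟩
  | all φ ih => exact ih h _ _
  | allS φ => exact h.elim
  | _ => trivial

theorem Fm.Delta0.arithmetical {φ : Fm} (h : φ.Delta0) : φ.Arithmetical := by
  induction h <;> simp_all [Fm.Arithmetical, Fm.ex, Fm.and, Fm.neg]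

/-- A substitution acts only on the parameters, so the result is again a comprehension axiom. -/
theorem comprehension_subst (φ : Fm) (σ : ℕ → Tm) (ρ : ℕ → ℕ) :
    (comprehension φ).subst σ ρ =
      comprehension (φ.subst (cons (.var 0) fun i => (σ i).lift) ρ) := by
  simp only [comprehension, Fm.exS, Fm.neg, Fm.iff, Fm.and, Fm.subst, Fm.liftS_subst, Tm.subst,
    cons]

theorem substClosed_ACA₀ : SubstClosed ACA₀ := by
  rintro φ ((h | rfl) | ⟨φ, hφ, rfl⟩) σ ρ
  · refine Or.inl (Or.inl ?_)
    have : φ.subst σ ρ = φ := by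
      rcases h with rfl | rfl | rfl | rfl | rfl | rfl | rfl | rfl | rfl | rfl <;> rfl
    rwa [this]
  · exact Or.inl (Or.inr rfl)
  · exact Or.inr ⟨_, hφ.subst _ _, comprehension_subst φ σ ρ⟩

theorem ECA₀_subset_ACA₀ : ECA₀ ⊆ ACA₀ :=
  Set.union_subset_union_right _ fun _ ⟨φ, hφ, h⟩ => ⟨φ, hφ.arithmetical, h⟩

/-! ## Evaluation of named formulas in a structure -/

section Evaluation

variable {N S : Type} [Interp N S] (v : ℕ → N) (V : ℕ → S)

theorem cons_zero {A : Type*} (a : A) (f : ℕ → A) : cons a f 0 = a := rfl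

theorem cons_succ {A : Type*} (a : A) (f : ℕ → A) (n : ℕ) : cons a f (n + 1) = f n := rfl

namespace Fm

theorem holds_neg (φ : Fm) : φ.neg.Holds v V ↔ ¬ φ.Holds v V := Iff.rfl

theorem holds_imp (φ ψ : Fm) : (φ.imp ψ).Holds v V ↔ (φ.Holds v V → ψ.Holds v V) := Iff.rfl

theorem holds_and (φ ψ : Fm) : (φ.and ψ).Holds v V ↔ φ.Holds v V ∧ ψ.Holds v V := by
  simp [and, neg, Holds]

theorem holds_or (φ ψ : Fm) : (φ.or ψ).Holds v V ↔ φ.Holds v V ∨ ψ.Holds v V := by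
  simp only [or, neg, Holds]; tauto

theorem holds_iff (φ ψ : Fm) : (φ.iff ψ).Holds v V ↔ (φ.Holds v V ↔ ψ.Holds v V) := by
  simp only [iff, holds_and, holds_imp]; tauto

theorem holds_all (φ : Fm) : φ.all.Holds v V ↔ ∀ n : N, φ.Holds (cons n v) V := Iff.rfl

theorem holds_allS (φ : Fm) : φ.allS.Holds v V ↔ ∀ A : S, φ.Holds v (cons A V) := Iff.rfl

theorem holds_ex (φ : Fm) : φ.ex.Holds v V ↔ ∃ n : N, φ.Holds (cons n v) V := by
  simp [ex, neg, Holds]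

theorem holds_exS (φ : Fm) : φ.exS.Holds v V ↔ ∃ A : S, φ.Holds v (cons A V) := by
  simp [exS, neg, Holds]

theorem holds_eq (t u : Tm) : (Fm.eq t u).Holds v V ↔ t.val v = u.val v := Iff.rfl

theorem holds_lt (t u : Tm) : (Fm.lt t u).Holds v V ↔ Interp.lt (t.val v) (u.val v) := Iff.rfl

theorem holds_mem (t : Tm) (X : ℕ) : (Fm.mem t X).Holds v V ↔ Interp.mem (t.val v) (V X) :=
  Iff.rfl

end Fm

theorem holds_comprehension (φ : Fm) :
    (comprehension φ).Holds v V ↔ ∃ A : S, ∀ n : N, Interp.mem n A ↔ φ.Holds (cons n v) V := by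
  simp only [comprehension, Fm.holds_exS, Fm.holds_all, Fm.holds_iff, Fm.holds_mem, Fm.liftS,
    Fm.holds_subst, Tm.val, cons_zero]
  rfl

theorem holds_app (φ : Fm) (x : NT) (d : ℕ) :
    (NF.app φ x d).Holds v V ↔ φ.Holds (fun _ => (x d).val v) V := by
  simp [NF.app, Fm.holds_subst]

theorem holds_app₂ (φ : Fm) (x y : NT) (d : ℕ) :
    (NF.app₂ φ x y d).Holds v V ↔ φ.Holds (cons ((x d).val v) fun _ => (y d).val v) V := by
  simp only [NF.app₂, Fm.holds_subst]
  rw [cons_comp (Tm.val v)]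
  rfl

theorem holds_appS (φ : Fm) (X : ℕ) (x : NT) (d : ℕ) :
    (NF.appS φ X x d).Holds v V ↔ φ.Holds (fun _ => (x d).val v) (fun _ => V X) := by
  simp [NF.appS, Fm.holds_subst]

theorem val_pr (x y : NT) (d : ℕ) : (pr x y d).val v = pr ((x d).val v) ((y d).val v) := rfl

/-- `x` is not in the finite set coded by `s`, in a structure. -/
def NotBit (x s : N) : Prop :=
  ¬ ∃ v, Interp.lt v (Interp.exp x) ∧ ∃ u, Interp.lt u (s + 1) ∧
    s = (u + u + 1) * Interp.exp x + v

/-- `x` is the Gödel number of a term, in a structure. -/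
def IsTerm (x : N) : Prop :=
  ∀ s : N, ((∀ i : N, NotBit (cVar i) s) ∧ NotBit cZero s ∧ NotBit cOne s ∧
    (∀ t, NotBit t s → NotBit (cExp t) s) ∧
    (∀ t u, NotBit t s ∧ NotBit u s → NotBit (cAdd t u) s) ∧
    (∀ t u, NotBit t s ∧ NotBit u s → NotBit (cMul t u) s)) → NotBit x s

/-- `x` is the Gödel number of a formula, in a structure. -/
def IsFormula (x : N) : Prop :=
  ∀ s : N, ((∀ t u : N, IsTerm t ∧ IsTerm u → NotBit (cEq t u) s) ∧
    (∀ t u : N, IsTerm t ∧ IsTerm u → NotBit (cLt t u) s) ∧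
    (∀ t i : N, IsTerm t → NotBit (cMem t i) s) ∧ NotBit cBot s ∧
    (∀ φ ψ : N, NotBit φ s ∧ NotBit ψ s → NotBit (cImp φ ψ) s) ∧
    (∀ φ : N, NotBit φ s → NotBit (cAll φ) s) ∧
    (∀ φ : N, NotBit φ s → NotBit (cAllS φ) s)) → NotBit x s

/-- Needs no induction inside `N`: every cofinite set closed under the rules contains `x` and the
code of `⊥`, hence that of the implication. -/
theorem IsFormula.cNeg {x : N} (h : IsFormula x) : IsFormula (cNeg x) :=
  fun s hs => hs.2.2.2.2.1 _ _ ⟨h s hs, hs.2.2.2.1⟩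

theorem holds_isFormula (n : N) (k : ℕ) :
    (NF.isFormula (NF.level k) (k + 1)).Holds (cons n v) V ↔ IsFormula n := by
  simp only [NF.isFormula, NF.isTerm, NF.notBit, NF.all, NF.ex, NF.bex, NF.neg, NF.imp, NF.and,
    NF.eq, NF.lt, Fm.holds_all, Fm.holds_ex, Fm.holds_imp, Fm.holds_and, Fm.holds_neg,
    Fm.holds_lt, Fm.holds_eq]
  simp only [IsFormula, IsTerm, NotBit]
  simp only [cVar, cZero, cOne, cExp, cAdd, cMul, cEq, cLt, cMem, cBot, cImp, cAll, cAllS,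
    val_pr, Tm.val]
  -- The scope depth `k` cancels in each index `e - (d + 1)`, leaving concrete indices although `k`
  -- is arbitrary.
  simp only [NF.level, Tm.val, Nat.add_sub_add_left, Nat.add_assoc, Nat.reduceAdd]
  rfl

/-- `IMC` enters only as a code built by `quote`, so no set variable is evaluated. This makes the
boxed condition the same for `X` and `Y`. -/
theorem holds_boxDiamondImp_congr {B : Fm} {m : ℕ} (hB : B.Closed m 0) (IMC : Fm) (x y z : NT)
    (d : ℕ) (W : ℕ → S) :
    (boxDiamondImp B IMC x y z d).Holds v V ↔ (boxDiamondImp B IMC x y z d).Holds v W := by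
  simp only [boxDiamondImp, NF.isNumeral, NF.notBit, NF.all, NF.ex, NF.bex, NF.neg, NF.imp,
    NF.and, NF.eq, NF.lt, Fm.holds_all, Fm.holds_ex, Fm.holds_imp, Fm.holds_and, Fm.holds_neg,
    Fm.holds_lt, Fm.holds_eq, holds_app]
  simp only [hB.holds_congr (V := V) (W := W) _ fun i hi => absurd hi i.not_lt_zero]

theorem val_cNeg (x : NT) (d : ℕ) : (cNeg x d).val v = cNeg ((x d).val v) := rfl

end Evaluation

/-! ## Uniqueness of iterated one-Münchhausen classes -/

/-- Two sets that satisfy the recursion up to `α` agree up to `α`, if `≺` is well-founded below `α`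
for the sets of disagreement. -/
theorem agree_of_recursion {N : Type*} {fld form Bx : N → Prop} {prec : N → N → Prop}
    {R : N → N → N → N → Prop} {inX inY : N → N → Prop} {ng : N → N}
    (hng : ∀ ψ, form ψ → form (ng ψ)) {a : N} (ha : fld a)
    (htrans : ∀ x y z, fld x → fld y → fld z → prec x y → prec y z → prec x z)
    (hirr : ∀ x, fld x → prec x a → ¬ prec x x)
    (hmin : (∃ x, fld x ∧ prec x a ∧ ∃ φ, form φ ∧ ¬ (inX x φ ↔ inY x φ)) →
      ∃ x, fld x ∧ prec x a ∧ (∃ φ, form φ ∧ ¬ (inX x φ ↔ inY x φ)) ∧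
        ∀ y, fld y → prec y a → (∃ φ, form φ ∧ ¬ (inX y φ ↔ inY y φ)) → prec x y ∨ x = y)
    (hX : ∀ x, fld x → prec x a ∨ x = a → ∀ φ, form φ → (inX x φ ↔ Bx φ ∨
      ∃ y, fld y ∧ prec y x ∧ ∃ ψ, form ψ ∧ ¬ inX y (ng ψ) ∧ R x φ y ψ))
    (hY : ∀ x, fld x → prec x a ∨ x = a → ∀ φ, form φ → (inY x φ ↔ Bx φ ∨
      ∃ y, fld y ∧ prec y x ∧ ∃ ψ, form ψ ∧ ¬ inY y (ng ψ) ∧ R x φ y ψ))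
    {x : N} (hx : fld x) (hxa : prec x a ∨ x = a) {φ : N} (hφ : form φ) :
    inX x φ ↔ inY x φ := by
  -- The two right-hand sides differ only in `inX y (ng ψ)` against `inY y (ng ψ)` with `y ≺ x`,
  -- which the induction hypothesis identifies.
  have step : ∀ x, fld x → prec x a ∨ x = a →
      (∀ y, fld y → prec y x → ∀ ψ, form ψ → (inX y ψ ↔ inY y ψ)) →
      ∀ φ, form φ → (inX x φ ↔ inY x φ) := by
    intro x hx hxa ih φ hφ
    rw [hX x hx hxa φ hφ, hY x hx hxa φ hφ]
    refine or_congr Iff.rfl (exists_congr fun y => and_congr_right fun hy =>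
      and_congr_right fun hyx => exists_congr fun ψ => and_congr_right fun hψ => ?_)
    rw [ih y hy hyx _ (hng ψ hψ)]
  have below : ∀ x, fld x → prec x a → ∀ φ, form φ → (inX x φ ↔ inY x φ) := by
    by_contra! hcon
    obtain ⟨x, hx, hxa, φ, hφ, hne⟩ := hcon
    obtain ⟨x, hx, hxa, ⟨φ, hφ, hne⟩, hle⟩ := hmin ⟨x, hx, hxa, φ, hφ, by tauto⟩
    refine hne (step x hx (.inl hxa) (fun y hy hyx ψ hψ => ?_) φ hφ)
    by_contra hne'
    -- A disagreeing `y ≺ x` lies below `a`, so minimality gives `x ≺ y` or `x = y`; either way `x ≺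
    -- x`.
    rcases hle y hy (htrans y x a hy hx ha hyx hxa) ⟨ψ, hψ, hne'⟩ with h | rfl
    · exact hirr x hx hxa (htrans x y x hx hy hx h hyx)
    · exact hirr x hx hxa hyx
  -- Well-foundedness covers only levels strictly below `a`; the level `a` itself takes one more
  -- application of `step`.
  rcases hxa with h | rfl
  · exact below x hx h φ hφ
  · exact step x hx (.inr rfl) below φ hφ

/-- `∃ φ ¬(⟨x, φ⟩ ∈ X ↔ ⟨x, φ⟩ ∈ Y)`, with `x` the number variable `0` and `X`, `Y` the set
variables `1` and `0`. -/
def disagreement : Fm :=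
  NF.formula₁ fun x => .ex fun φ => NF.isFormula φ ⋀ .neg (pr x φ ∈ₛ 1 ⇔ pr x φ ∈ₛ 0)

/-- Its number quantifiers are unbounded but it has no set quantifiers, so `ACA₀` offers
comprehension for it. This is the only comprehension instance invoked in the uniqueness argument. -/
theorem arithmetical_disagreement : disagreement.Arithmetical := by
  simp [disagreement, NF.formula₁, NF.isFormula, NF.isTerm, NF.notBit, NF.all, NF.ex, NF.bex,
    NF.neg, NF.imp, NF.and, NF.iff, NF.eq, NF.lt, NF.mem, Fm.ex, Fm.and, Fm.neg, Fm.iff,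
    Fm.Arithmetical]

end Munchhausen

/-- `ACA₀ + wo(α)` proves `∃^{≤1} X IMC(X, α)`, for all `α`. -/
theorem mainTheorem5 (U : Set Munchhausen.Fm)
    (hU : Munchhausen.Extends U Munchhausen.ECA₀)
    (L : Munchhausen.OrdNotation)
    (B : Munchhausen.Fm) (hB : Munchhausen.IsProvabilityPredicate U B)
    (IMC : Munchhausen.Fm) (hIMC : Munchhausen.IsIMC L B IMC) :
    Munchhausen.Proves Munchhausen.ACA₀
      (Munchhausen.NF.sentence
        (L.all fun α => Munchhausen.NF.imp (L.wo α) (Munchhausen.atMostOneIMC L IMC α))) := by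
  open Munchhausen in
  refine proves_of_holds substClosed_ACA₀ fun N S _ hM v V => ?_
  have hrec := hM _ (hIMC.recursion.mono ECA₀_subset_ACA₀) v V
  have htrans := hM _ (L.lt_trans.mono ECA₀_subset_ACA₀) v V
  have hcompr (W : ℕ → S) := hM (comprehension disagreement)
    (.ax (Or.inr ⟨_, arithmetical_disagreement, rfl⟩)) v W
  have hfld (w : ℕ → N) (W : ℕ → S) : L.fld.Holds w W ↔ L.fld.Holds w V :=
    L.fld_closed.holds_congr w fun i hi => absurd hi i.not_lt_zero
  have hlt (w : ℕ → N) (W : ℕ → S) : L.lt.Holds w W ↔ L.lt.Holds w V :=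
    L.lt_closed.holds_congr w fun i hi => absurd hi i.not_lt_zero
  have hBV (w : ℕ → N) (W : ℕ → S) : B.Holds w W ↔ B.Holds w V :=
    hB.closed.holds_congr w fun i hi => absurd hi i.not_lt_zero
  have hbox (x y z : NT) (d : ℕ) (w : ℕ → N) (W : ℕ → S) :
      (boxDiamondImp B IMC x y z d).Holds w W ↔ (boxDiamondImp B IMC x y z d).Holds w V :=
    holds_boxDiamondImp_congr w W hB.closed IMC x y z d V
  simp only [NF.sentence, OrdNotation.all, OrdNotation.ex, OrdNotation.wo, OrdNotation.prec,
    OrdNotation.preceq, atMostOneIMC, equivUpTo, imcStep, NF.all, NF.allS, NF.ex, NF.neg, NF.imp,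
    NF.and, NF.or, NF.iff, NF.eq, NF.mem, Fm.holds_all, Fm.holds_allS, Fm.holds_ex, Fm.holds_imp,
    Fm.holds_and, Fm.holds_or, Fm.holds_iff, Fm.holds_neg, Fm.holds_mem, Fm.holds_eq, holds_app,
    holds_app₂, holds_appS, val_pr, val_cNeg, holds_comprehension, disagreement, NF.formula₁,
    holds_isFormula, hfld, hlt, hBV, hbox, Nat.zero_add] at hrec htrans hcompr ⊢
  simp only [NF.level, Tm.val, Nat.reduceAdd, Nat.reduceSub, cons_zero, cons_succ]
    at hrec htrans hcompr ⊢
  rintro a ha ⟨hirr, -, -, hmin⟩ X Y ⟨hX, hY⟩ x hx hxa φ hφ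
  -- This valuation makes `Y` and `X` the set variables `0` and `1`, as `disagreement` expects; `D`
  -- collects the levels where they differ.
  obtain ⟨D, hD⟩ := hcompr (cons Y (cons X V))
  simp only [cons_zero, cons_succ] at hD
  have hminD := hmin D
  simp only [hD] at hminD
  -- `Bx` and `R` are found by unification as the truth of `B` and of the boxed condition. They
  -- coincide for `X` and `Y` because `hBV` and `hbox` have moved both to the common valuation `V`.
  exact agree_of_recursion (fld := fun x => L.fld.Holds (fun _ => x) V)
    (prec := fun x y => L.lt.Holds (cons x fun _ => y) V) (inX := fun x φ => Interp.mem (pr x φ) X)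
    (inY := fun x φ => Interp.mem (pr x φ) Y) (fun ψ hψ => IsFormula.cNeg hψ) ha
    (fun x y z hx hy hz h h' => htrans x y z ⟨hx, hy, hz⟩ ⟨h, h'⟩) hirr
    (fun h => (hminD h).imp fun x hx => ⟨hx.1, hx.2.1, hx.2.2.1,
      fun y hy hya hyD => hx.2.2.2 y hy ⟨hya, hyD⟩⟩)
    ((hrec X a ha).1 hX) ((hrec Y a ha).1 hY) hx hxa hφ
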